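/- Let $A$ be an associative ring with unit and let $D(A)$ be the unbounded derived category of cochain complexes of left $A$-modules. Let $\sigma=\{s_i\colon P_i\to Q_i\}$ be a set of maps between finitely generated projective left $A$-modules. View each $s_i$ as the object $\cdots\to 0\to P_i\xrightarrow{s_i}Q_i\to 0\to\cdots$ of $D(A)$, with $P_i$ in degree $0$ and $Q_i$ in degree $1$. Let $\mathcal R\subseteq D(A)$ be the smallest triangulated subcategory which contains all these objects and is closed in $D(A)$ under arbitrary (set-indexed) coproducts. Call an object $y\in D(A)$ $\sigma$-local if $\operatorname{Hom}_{D(A)}(r,y)=0$ for all $r\in\mathcal R$. For $x\in D(A)$ and $n\in\mathbb Z$, let $x^{\le n}$ and $x^{\ge n}$ be the truncations of $x$ for the standard t-structure on $D(A)$, in which $D(A)^{\le n}$ (resp. $D(A)^{\ge n}$) consists of the complexes whose cohomology vanishes in all degrees $>n$ (resp. $<n$). If $x\in D(A)$ is $\sigma$-local, then for every $n\in\mathbb Z$ the truncations $x^{\le n}$ and $x^{\ge n}$ are $\sigma$-local. -/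

import Mathlib

open CategoryTheory Limits

universe t v u w

namespace CohnLocal

section Localizing

variable {C : Type u} [Category.{v} C] [Preadditive C] [HasZeroObject C] [HasShift C ℤ]
  [∀ n : ℤ, (shiftFunctor C n).Additive] [Pretriangulated C]

/-- `P` is (the class of objects of) a strictly full triangulated subcategory of `C` which is
closed in `C` under coproducts indexed by arbitrary sets (types in universe `t`). -/
structure IsLocalizing (P : ObjectProperty C) : Prop where
  isClosedUnderIsomorphisms : P.IsClosedUnderIsomorphisms
  isTriangulated : P.IsTriangulated
  isClosedUnderCoproducts (J : Type t) : P.IsClosedUnderColimitsOfShape (Discrete J)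

/-- The smallest triangulated subcategory of `C` which contains the objects in `S` and is
closed in `C` under arbitrary coproducts: the intersection of all such subcategories. -/
def localizingSubcategory (S : ObjectProperty C) : ObjectProperty C :=
  fun X => ∀ P : ObjectProperty C, IsLocalizing.{t} P → S ≤ P → P X

lemma le_localizingSubcategory (S : ObjectProperty C) : S ≤ localizingSubcategory.{t} S :=
  fun X hX _ _ hS => hS X hX

lemma localizingSubcategory_le {S P : ObjectProperty C} (hP : IsLocalizing.{t} P) (hS : S ≤ P) :
    localizingSubcategory.{t} S ≤ P :=
  fun _ hX => hX P hP hS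

lemma isLocalizing_localizingSubcategory (S : ObjectProperty C) :
    IsLocalizing.{t} (localizingSubcategory.{t} S) where
  isClosedUnderIsomorphisms :=
    { of_iso := fun e hX P hP hS =>
        have := hP.isClosedUnderIsomorphisms
        P.prop_of_iso e (hX P hP hS) }
  isTriangulated :=
    { exists_zero := ⟨_, isZero_zero C, fun P hP _ => by
        have := hP.isClosedUnderIsomorphisms
        have := hP.isTriangulated
        exact P.prop_zero⟩
      isStableUnderShiftBy := fun a => ⟨fun X hX P hP hS => by
        have := hP.isTriangulated
        exact P.le_shift a _ (hX P hP hS)⟩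
      ext₂' := fun T hT h₁ h₃ => ObjectProperty.le_isoClosure _ _ fun P hP hS => by
        have := hP.isClosedUnderIsomorphisms
        have := hP.isTriangulated
        exact P.ext_of_isTriangulatedClosed₂ T hT (h₁ P hP hS) (h₃ P hP hS) }
  isClosedUnderCoproducts J :=
    { colimitsOfShape_le := by
        rintro X ⟨h⟩ P hP hS
        have := hP.isClosedUnderCoproducts J
        exact P.prop_of_isColimit h.isColimit fun j => h.prop_diag_obj j P hP hS }

end Localizing

section DerivedCategory

variable {A : Type u} [Ring A] [HasDerivedCategory.{w} (ModuleCat.{u} A)]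

/-- The object of `D(A)` given by the complex `⋯ ⟶ 0 ⟶ P ⟶ Q ⟶ 0 ⟶ ⋯` whose only possibly
nonzero differential is `s : P ⟶ Q`, with `P` in degree `0` and `Q` in degree `1`. -/
noncomputable def twoTerm {P Q : ModuleCat.{u} A} (s : P ⟶ Q) :
    DerivedCategory (ModuleCat.{u} A) :=
  DerivedCategory.Q.obj
    (HomologicalComplex.double s (show (ComplexShape.up ℤ).Rel 0 1 from zero_add 1))

variable {ι : Type t} {P Q : ι → ModuleCat.{u} A} (σ : ∀ i, P i ⟶ Q i)

/-- The subcategory `R ⊆ D(A)`: the smallest triangulated subcategory of `D(A)` which contains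
all maps in `σ`, viewed as two-term complexes, and is closed under arbitrary coproducts. -/
noncomputable def R : ObjectProperty (DerivedCategory (ModuleCat.{u} A)) :=
  localizingSubcategory.{u} (ObjectProperty.ofObj fun i => twoTerm (σ i))

/-- An object `y` of `D(A)` is `σ`-local if `Hom(r, y) = 0` for all `r` in `R`. -/
def IsLocal (y : DerivedCategory (ModuleCat.{u} A)) : Prop :=
  ∀ r : DerivedCategory (ModuleCat.{u} A), R σ r → ∀ f : r ⟶ y, f = 0

end DerivedCategory

end CohnLocal

namespace CohnLocal

/-! Locality of `y` amounts to `Hom(s_i, y[m]) = 0` for all `i` and `m`, because the objects with no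
maps to any shift of `y` form a localizing subcategory. Each `s_i` is a complex of projectives in
degrees 0 and 1, so it has no maps to `D^{≤ -1}` or to `D^{≥ 2}`. For `m > n`, `x^{≤n}[m]` lies in
`D^{≤ -1}`. For `m ≤ n`, `x^{≥n+1}[m-1]` lies in `D^{≥ 2}`, so `Hom(s_i, x^{≤n}[m])` injects into
`Hom(s_i, x[m]) = 0`. The truncation triangle then gives `x^{≥n}`. -/

section Orthogonal

variable {C : Type u} [Category.{v} C] [Preadditive C] [HasZeroObject C] [HasShift C ℤ]
  [∀ n : ℤ, (shiftFunctor C n).Additive] [Pretriangulated C]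

/-- The objects which are isomorphic to a shift of `y`. -/
def shifts (y : C) : ObjectProperty C := fun z => ∃ m : ℤ, Nonempty (z ≅ y⟦m⟧)

instance (y : C) : (shifts y).IsStableUnderShift ℤ where
  isStableUnderShiftBy a := ⟨by
    rintro z ⟨m, ⟨e⟩⟩
    exact ⟨m + a, ⟨(shiftFunctor C a).mapIso e ≪≫ (shiftFunctorAdd C m a).symm.app y⟩⟩⟩

/-- A map out of a coproduct is determined by its components; shift stability of `S` makes the
orthogonal triangulated. -/
lemma isLocalizing_leftOrthogonal (S : ObjectProperty C) [S.IsStableUnderShift ℤ] :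
    IsLocalizing.{t} S.leftOrthogonal where
  isClosedUnderIsomorphisms :=
    { of_iso := fun e hX Z f hZ => by
        rw [← cancel_epi e.hom, hX (e.hom ≫ f) hZ, comp_zero] }
  isTriangulated := inferInstance
  isClosedUnderCoproducts J :=
    { colimitsOfShape_le := by
        rintro X ⟨h⟩ Z f hZ
        exact h.isColimit.hom_ext fun j => by
          rw [h.prop_diag_obj j (_ ≫ f) hZ, comp_zero] }

/-- Being right orthogonal to a localizing subcategory can be tested on shifted morphisms
from the generators. -/
lemma rightOrthogonal_localizingSubcategory_iff (S : ObjectProperty C) (y : C) :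
    (localizingSubcategory.{t} S).rightOrthogonal y ↔
      ∀ r, S r → ∀ (m : ℤ) (f : r ⟶ y⟦m⟧), f = 0 := by
  refine ⟨fun hy r hr m f => ?_, fun hy r f hr => ?_⟩
  · have := (isLocalizing_localizingSubcategory.{t} S).isTriangulated
    exact (localizingSubcategory.{t} S).rightOrthogonal.le_shift m _ hy f
      (le_localizingSubcategory S r hr)
  · have key : S ≤ (shifts y).leftOrthogonal := by
      rintro r hr z f ⟨m, ⟨e⟩⟩
      rw [← cancel_mono e.hom, hy r hr m (f ≫ e.hom), zero_comp]
    exact localizingSubcategory_le (isLocalizing_leftOrthogonal.{t} _) key r hr f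
      ⟨0, ⟨((shiftFunctorZero C ℤ).app y).symm⟩⟩

/-- If two vertices of a distinguished triangle are right orthogonal to a localizing subcategory,
then so is the third one. -/
lemma rightOrthogonal_localizingSubcategory_obj₃ (S : ObjectProperty C)
    {T : Pretriangulated.Triangle C} (hT : T ∈ Pretriangulated.distinguishedTriangles)
    (h₁ : (localizingSubcategory.{t} S).rightOrthogonal T.obj₁)
    (h₂ : (localizingSubcategory.{t} S).rightOrthogonal T.obj₂) :
    (localizingSubcategory.{t} S).rightOrthogonal T.obj₃ :=
  have := (isLocalizing_localizingSubcategory.{t} S).isTriangulated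
  (localizingSubcategory.{t} S).rightOrthogonal.ext_of_isTriangulatedClosed₃ T hT h₁ h₂

/-- A morphism to the first vertex of a shifted distinguished triangle vanishes if all morphisms
to the second vertex and to the desuspension of the third vertex do. -/
lemma hom_shift_obj₁_eq_zero {T : Pretriangulated.Triangle C}
    (hT : T ∈ Pretriangulated.distinguishedTriangles) {X : C} (m : ℤ)
    (h₂ : ∀ f : X ⟶ T.obj₂⟦m⟧, f = 0) (h₃ : ∀ f : X ⟶ T.obj₃⟦m⟧⟦(-1 : ℤ)⟧, f = 0)
    (f : X ⟶ T.obj₁⟦m⟧) : f = 0 := by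
  -- Inverse rotation puts the first vertex in the middle, so `f` factors through the desuspended
  -- third vertex.
  obtain ⟨g, hg⟩ := Pretriangulated.Triangle.coyoneda_exact₂ _
    (Pretriangulated.inv_rot_of_distTriang _
      (Pretriangulated.Triangle.shift_distinguished T hT m)) f (h₂ _)
  obtain rfl : g = 0 := h₃ g
  exact hg.trans zero_comp

end Orthogonal

section TwoTerm

open DerivedCategory

variable {A : Type u} [Ring A] {P Q : ModuleCat.{u} A} (s : P ⟶ Q)

lemma isStrictlyLE_double :
    CochainComplex.IsStrictlyLE (HomologicalComplex.double s
      (show (ComplexShape.up ℤ).Rel 0 1 from zero_add 1)) 1 := by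
  rw [CochainComplex.isStrictlyLE_iff]
  intro i hi
  exact HomologicalComplex.isZero_double_X _ _ _ (by lia) (by lia)

lemma isKProjective_double [Module.Projective A P] [Module.Projective A Q] :
    CochainComplex.IsKProjective (HomologicalComplex.double s
      (show (ComplexShape.up ℤ).Rel 0 1 from zero_add 1)) := by
  have := isStrictlyLE_double s
  have (n : ℤ) : Projective ((HomologicalComplex.double s
      (show (ComplexShape.up ℤ).Rel 0 1 from zero_add 1)).X n) := by
    by_cases h₀ : n = 0
    · subst h₀
      exact Projective.of_iso (HomologicalComplex.doubleXIso₀ s _).symm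
        (ModuleCat.projective_of_categoryTheory_projective P)
    by_cases h₁ : n = 1
    · subst h₁
      exact Projective.of_iso (HomologicalComplex.doubleXIso₁ s _ (by simp)).symm
        (ModuleCat.projective_of_categoryTheory_projective Q)
    exact (HomologicalComplex.isZero_double_X s _ n h₀ h₁).projective
  exact CochainComplex.isKProjective_of_projective _ 1

/-- Out of a K-projective complex, every morphism of the derived category comes from a chain map. -/
lemma Q_obj_hom_eq_zero {C : Type u} [Category.{v} C] [Abelian C] [HasDerivedCategory.{w} C]
    (K L : CochainComplex C ℤ) [K.IsKProjective] (h : ∀ g : K ⟶ L, g = 0)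
    (f : DerivedCategory.Q.obj K ⟶ DerivedCategory.Q.obj L) : f = 0 := by
  obtain ⟨g, hg⟩ := (CochainComplex.IsKProjective.Qh_map_bijective K
    ((HomotopyCategory.quotient _ _).obj L)).surjective
      ((quotientCompQhIso C).hom.app K ≫ f ≫ (quotientCompQhIso C).inv.app L)
  obtain ⟨g, rfl⟩ := (HomotopyCategory.quotient _ _).map_surjective g
  rw [h g, Functor.map_zero, Functor.map_zero] at hg
  rw [← cancel_epi ((quotientCompQhIso C).hom.app K),
    ← cancel_mono ((quotientCompQhIso C).inv.app L), Category.assoc, ← hg]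
  simp

variable [HasDerivedCategory.{w} (ModuleCat.{u} A)]

lemma isLE_twoTerm : (twoTerm s).IsLE 1 :=
  have := isStrictlyLE_double s
  inferInstanceAs ((DerivedCategory.Q.obj _).IsLE 1)

/-- A two-term complex of projective modules in degrees `0` and `1` has no nonzero morphisms
in the derived category to complexes concentrated in negative degrees. -/
lemma twoTerm_hom_eq_zero_of_isLE [Module.Projective A P] [Module.Projective A Q]
    {y : DerivedCategory (ModuleCat.{u} A)} (n : ℤ) (hn : n < 0) (hy : y.IsLE n)
    (f : twoTerm s ⟶ y) : f = 0 := by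
  obtain ⟨L, hL, ⟨e⟩⟩ := y.exists_iso_Q_obj_of_isLE n
  have := isKProjective_double s
  rw [← cancel_mono e.hom, zero_comp]
  refine Q_obj_hom_eq_zero _ L (fun g => HomologicalComplex.from_double_hom_ext ?_ ?_) (f ≫ e.hom)
  · exact (L.isZero_of_isStrictlyLE n 0 (by lia)).eq_of_tgt _ _
  · exact (L.isZero_of_isStrictlyLE n 1 (by lia)).eq_of_tgt _ _

lemma twoTerm_hom_eq_zero_of_isGE {y : DerivedCategory (ModuleCat.{u} A)} (n : ℤ) (hn : 1 < n)
    (hy : y.IsGE n) (f : twoTerm s ⟶ y) : f = 0 :=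
  TStructure.t.zero_of_isLE_of_isGE f 1 n hn (isLE_twoTerm s) hy

end TwoTerm

section Local

variable {A : Type u} [Ring A] [HasDerivedCategory.{w} (ModuleCat.{u} A)]
  {ι : Type t} {P Q : ι → ModuleCat.{u} A} {σ : ∀ i, P i ⟶ Q i}

lemma isLocal_iff_rightOrthogonal (y : DerivedCategory (ModuleCat.{u} A)) :
    IsLocal σ y ↔ (R σ).rightOrthogonal y :=
  ⟨fun h r f hr => h r hr f, fun h _ hr f => h f hr⟩

lemma isLocal_iff (y : DerivedCategory (ModuleCat.{u} A)) :
    IsLocal σ y ↔ ∀ i (m : ℤ) (f : twoTerm (σ i) ⟶ y⟦m⟧), f = 0 := by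
  rw [isLocal_iff_rightOrthogonal, R, rightOrthogonal_localizingSubcategory_iff]
  refine ⟨fun h i => h _ ⟨i⟩, ?_⟩
  rintro h _ ⟨i⟩
  exact h i

open DerivedCategory.TStructure

lemma IsLocal.truncLE (hP : ∀ i, Module.Projective A (P i)) (hQ : ∀ i, Module.Projective A (Q i))
    {x : DerivedCategory (ModuleCat.{u} A)} (hx : IsLocal σ x) (n : ℤ) :
    IsLocal σ ((t.truncLE n).obj x) := by
  rw [isLocal_iff] at hx ⊢
  intro i m f
  have := hP i
  have := hQ i
  by_cases hm : n < m
  · exact twoTerm_hom_eq_zero_of_isLE (σ i) (n - m) (by lia)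
      (t.isLE_shift _ n m (n - m) (by lia)) f
  -- Here `m ≤ n`, so the bound `n + 2 - m` exceeds 1, the top degree of `s_i`.
  · refine hom_shift_obj₁_eq_zero (t.triangleLEGE_distinguished n (n + 1) rfl x) m (hx i m)
      (twoTerm_hom_eq_zero_of_isGE (σ i) (n + 2 - m) (by lia) ?_) f
    have := t.isGE_shift ((t.truncGE (n + 1)).obj x) (n + 1) m (n + 1 - m) (by lia)
    exact t.isGE_shift (((t.truncGE (n + 1)).obj x)⟦m⟧) (n + 1 - m) (-1) (n + 2 - m) (by lia)

lemma IsLocal.truncGE (hP : ∀ i, Module.Projective A (P i)) (hQ : ∀ i, Module.Projective A (Q i))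
    {x : DerivedCategory (ModuleCat.{u} A)} (hx : IsLocal σ x) (n : ℤ) :
    IsLocal σ ((t.truncGE n).obj x) := by
  have hLE := hx.truncLE hP hQ (n - 1)
  rw [isLocal_iff_rightOrthogonal] at hx hLE ⊢
  have hT := t.triangleLEGE_distinguished (n - 1) n (by lia) x
  exact rightOrthogonal_localizingSubcategory_obj₃
    (ObjectProperty.ofObj fun i => twoTerm (σ i))
    (T := (t.triangleLEGE (n - 1) n (by lia)).obj x) hT hLE hx

end Local

end CohnLocal

theorem lemma6p2 {A : Type u} [Ring A] [HasDerivedCategory.{w} (ModuleCat.{u} A)]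
    {ι : Type t} (P Q : ι → ModuleCat.{u} A)
    (hPfin : ∀ i, Module.Finite A (P i)) (hPproj : ∀ i, Module.Projective A (P i))
    (hQfin : ∀ i, Module.Finite A (Q i)) (hQproj : ∀ i, Module.Projective A (Q i))
    (σ : ∀ i, P i ⟶ Q i)
    (x : DerivedCategory (ModuleCat.{u} A)) (hx : CohnLocal.IsLocal σ x) (n : ℤ) :
    CohnLocal.IsLocal σ ((DerivedCategory.TStructure.t.truncLE n).obj x) ∧
      CohnLocal.IsLocal σ ((DerivedCategory.TStructure.t.truncGE n).obj x) := by
  exact ⟨hx.truncLE hPproj hQproj n, hx.truncGE hPproj hQproj n⟩
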